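/- Let $\mathcal{M}_{\mathbb{Q}}$ be the semigroup, under composition, of all (non-strictly) increasing maps $s\colon\mathbb{Q}\to\mathbb{Q}$. A *Polish semigroup topology* on $\mathcal{M}_{\mathbb{Q}}$ is a second countable, completely metrisable topology for which the composition $\mathcal{M}_{\mathbb{Q}}\times\mathcal{M}_{\mathbb{Q}}\to\mathcal{M}_{\mathbb{Q}}$ is continuous. The *pointwise topology* $\mathcal{T}_{pw}$ is the subspace topology induced by the product topology on $\mathbb{Q}^{\mathbb{Q}}$, where each copy of $\mathbb{Q}$ is discrete. The *rich topology* $\mathcal{T}_{rich}$ is the topology on $\mathcal{M}_{\mathbb{Q}}$ generated by the following sets, where all intervals consist of rational points only: - $\{s : s(x)=y\}$ for $x,y\in\mathbb{Q}$; - $\{s : s(I)\subseteq J\}$ where, for some $p,q\in\mathbb{Q}$, either $I=(-\infty,p)$ and $J\in\{(-\infty,q],(-\infty,q)\}$, or $I=(p,+\infty)$ and $J\in\{[q,+\infty),(q,+\infty)\}$; - $\{s : \inf \operatorname{Im}(s)\in L,\ \sup \operatorname{Im}(s)\in U\}$, where the infimum and supremum are taken in $\mathbb{R}\cup\{\pm\infty\}$,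 $L$ is $\mathbb{R}$ or $\{-\infty\}$, and $U$ is $\mathbb{R}$ or $\{+\infty\}$; - $\{s : \operatorname{Im}(s)\cap K=\emptyset\}$ for $K\in\{[q_1,q_2],[q_1,q_2),(q_1,q_2],(q_1,q_2)\}$ with $q_1,q_2\in\mathbb{Q}\cup\{\pm\infty\}$, $q_1\le q_2$. Let $\mathcal{T}$ be a Polish semigroup topology on $\mathcal{M}_{\mathbb{Q}}$ such that $\mathcal{T}_{pw}\subseteq\mathcal{T}\subseteq\mathcal{T}_{rich}$. Then $\mathcal{T}=\mathcal{T}_{pw}$. -/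

import Mathlib

open Set Topology

/-- The semigroup `M_ℚ` of all increasing (that is, non-strictly monotone) maps `ℚ → ℚ`, under
composition. -/
abbrev MQ : Type := ℚ →o ℚ

/-- A Polish semigroup topology on `M_ℚ`: a Polish topology for which the composition map
`M_ℚ × M_ℚ → M_ℚ`, `(f, g) ↦ f ∘ g`, is continuous. -/
def IsPolishSemigroupTopology (T : TopologicalSpace MQ) : Prop :=
  @PolishSpace MQ T ∧
    @Continuous (MQ × MQ) MQ (@instTopologicalSpaceProd MQ MQ T T) T
      (fun p : MQ × MQ => p.1.comp p.2)

/-- The pointwise topology: the subspace topology inherited from the product topology on `ℚ → ℚ`,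
where each copy of `ℚ` is discrete (on topological spaces, `⊥` is the discrete topology). -/
def pointwiseTopology : TopologicalSpace MQ :=
  TopologicalSpace.induced (fun (s : MQ) (x : ℚ) => s x)
    (@Pi.topologicalSpace ℚ (fun _ => ℚ) (fun _ => ⊥))

/-- Sets `{s | s x = y}` with `x, y ∈ ℚ`. -/
def pointwiseSets : Set (Set MQ) :=
  {O | ∃ x y : ℚ, O = {s : MQ | s x = y}}

/-- Sets `{s | s(I) ⊆ J}` where, for some `p, q ∈ ℚ`, either `I = (-∞, p)` and `J` is `(-∞, q]` or
`(-∞, q)`, or `I = (p, +∞)` and `J` is `[q, +∞)` or `(q, +∞)`. -/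
def generalisedPointwiseSets : Set (Set MQ) :=
  {O | ∃ (I J : Set ℚ) (p q : ℚ),
    ((I = Iio p ∧ (J = Iic q ∨ J = Iio q)) ∨ (I = Ioi p ∧ (J = Ici q ∨ J = Ioi q))) ∧
      O = {s : MQ | s '' I ⊆ J}}

/-- The infimum of the image of `s`, in `[-∞, +∞]`. -/
noncomputable def infImage (s : MQ) : EReal := ⨅ x : ℚ, ((s x : ℝ) : EReal)

/-- The supremum of the image of `s`, in `[-∞, +∞]`. -/
noncomputable def supImage (s : MQ) : EReal := ⨆ x : ℚ, ((s x : ℝ) : EReal)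

/-- The four boundedness types: sets `{s | inf Im(s) ∈ L, sup Im(s) ∈ U}` where `L` is `ℝ` or
`{-∞}` and `U` is `ℝ` or `{+∞}`. -/
def boundednessSets : Set (Set MQ) :=
  {O | ∃ L U : Set EReal,
    (L = range Real.toEReal ∨ L = {⊥}) ∧ (U = range Real.toEReal ∨ U = {⊤}) ∧
      O = {s : MQ | infImage s ∈ L ∧ supImage s ∈ U}}

/-- The rational points of an interval with endpoints in `ℚ ∪ {±∞}`: the preimage in `ℚ` of a set
of extended rationals. -/
def ratPoints (K : Set (WithBot (WithTop ℚ))) : Set ℚ :=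
  {x : ℚ | ((x : WithTop ℚ) : WithBot (WithTop ℚ)) ∈ K}

/-- Sets `{s | Im(s) ∩ K = ∅}` where `K` is the set of rational points of one of the intervals
`[q₁, q₂]`, `[q₁, q₂)`, `(q₁, q₂]`, `(q₁, q₂)`, with `q₁ ≤ q₂` in `ℚ ∪ {±∞}`. -/
def avoidingSets : Set (Set MQ) :=
  {O | ∃ (q₁ q₂ : WithBot (WithTop ℚ)) (K : Set (WithBot (WithTop ℚ))), q₁ ≤ q₂ ∧
    (K = Icc q₁ q₂ ∨ K = Ico q₁ q₂ ∨ K = Ioc q₁ q₂ ∨ K = Ioo q₁ q₂) ∧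
      O = {s : MQ | range s ∩ ratPoints K = ∅}}

/-- The rich topology: the topology generated by all sets of the four kinds above. -/
def richTopology : TopologicalSpace MQ :=
  TopologicalSpace.generateFrom
    (pointwiseSets ∪ generalisedPointwiseSets ∪ boundednessSets ∪ avoidingSets)

/-! The core claim is that every `T`-neighbourhood of `s` contains all maps unbounded on both sides
that agree with `s` on some finite set. Such maps are pointwise dense, so regularity of `T` removes
the unboundedness condition. At a surjection `π` whose fibres have no endpoints, the rich sets give
the claim directly. Right translation by a section of `π` carries it to the identity. Baire category
then makes surjections dense: a map missing `y` is `f ∘ g`, and `f ∘ k ∘ g` attains `y` for some `k`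
near the identity. For general `s`, write `s = π ∘ g ∘ id` with `g` injective and replace `g` by a
nearby surjection `g'`. Every unbounded `s'` close to `s` is then `π ∘ g' ∘ K` with `K` near the
identity. -/

/-- Maps that are unbounded below and above. -/
def UnboundedBothSides (s : MQ) : Prop :=
  (∀ c, ∃ x, s x ≤ c) ∧ ∀ c, ∃ x, c ≤ s x

lemma infImage_eq_bot {s : MQ} (hs : UnboundedBothSides s) : infImage s = ⊥ := by
  refine iInf_eq_bot.2 fun b hb => ?_
  obtain ⟨c, -, hc⟩ := EReal.lt_iff_exists_rat_btwn.1 hb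
  obtain ⟨x, hx⟩ := hs.1 c
  refine ⟨x, lt_of_le_of_lt ?_ hc⟩
  exact_mod_cast hx

lemma supImage_eq_top {s : MQ} (hs : UnboundedBothSides s) : supImage s = ⊤ := by
  refine iSup_eq_top.2 fun b hb => ?_
  obtain ⟨c, hc, -⟩ := EReal.lt_iff_exists_rat_btwn.1 hb
  obtain ⟨x, hx⟩ := hs.2 c
  refine ⟨x, lt_of_lt_of_le hc ?_⟩
  exact_mod_cast hx

/-! ### Locally constant surjections and the rich topology -/

/-- There is an increasing surjection `π` of `ℚ` all of whose fibres have no endpoints, together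
with a section `j y x` parametrised by the lexicographic product. -/
lemma exists_locallyConstant_surjection : ∃ (π : MQ) (j : ℚ → ℚ → ℚ),
    (∀ y x, π (j y x) = y) ∧ (∀ y y' x x', y < y' → j y x < j y' x') ∧
      (∀ y x x', x < x' → j y x < j y x') ∧
        ∀ p, ∃ a b, a < p ∧ p < b ∧ π a = π p ∧ π b = π p := by
  have : Countable (ℚ ×ₗ ℚ) := inferInstanceAs (Countable (ℚ × ℚ))
  obtain ⟨e⟩ := Order.iso_of_countable_dense ℚ (ℚ ×ₗ ℚ)
  have key : ∀ p : ℚ, p = e.symm (toLex ((ofLex (e p)).1, (ofLex (e p)).2)) := fun p => by simp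
  have hfst : ∀ y x, (ofLex (e (e.symm (toLex (y, x))))).1 = y := fun y x => by simp
  refine ⟨⟨fun p => (ofLex (e p)).1, fun a b h => Prod.Lex.monotone_fst _ _ (e.monotone h)⟩,
    fun y x => e.symm (toLex (y, x)), hfst, ?_, ?_, ?_⟩
  · intro y y' x x' h
    exact e.symm.strictMono (Prod.Lex.toLex_lt_toLex.2 (Or.inl h))
  · intro y x x' h
    exact e.symm.strictMono (Prod.Lex.toLex_lt_toLex.2 (Or.inr ⟨rfl, h⟩))
  · intro p
    refine ⟨e.symm (toLex ((ofLex (e p)).1, (ofLex (e p)).2 - 1)),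
      e.symm (toLex ((ofLex (e p)).1, (ofLex (e p)).2 + 1)), ?_, ?_, hfst _ _, hfst _ _⟩
    · conv_rhs => rw [key p]
      exact e.symm.strictMono (Prod.Lex.toLex_lt_toLex.2 (Or.inr ⟨rfl, by simp⟩))
    · conv_lhs => rw [key p]
      exact e.symm.strictMono (Prod.Lex.toLex_lt_toLex.2 (Or.inr ⟨rfl, by simp⟩))

/-- At a locally constant surjection, rich neighbourhoods are no finer than pointwise ones, as far
as maps unbounded on both sides are concerned. -/
lemma exists_finset_of_isOpen_rich {π : MQ} (hsurj : Function.Surjective π)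
    (hloc : ∀ p, ∃ a b, a < p ∧ p < b ∧ π a = π p ∧ π b = π p)
    {O : Set MQ} (hO : IsOpen[richTopology] O) (hπ : π ∈ O) :
    ∃ E : Finset ℚ, ∀ f : MQ, UnboundedBothSides f → (∀ x ∈ E, f x = π x) → f ∈ O := by
  have hub : UnboundedBothSides π :=
    ⟨fun c => (hsurj c).imp fun _ h => h.le, fun c => (hsurj c).imp fun _ h => h.ge⟩
  have hO' : TopologicalSpace.GenerateOpen
    (pointwiseSets ∪ generalisedPointwiseSets ∪ boundednessSets ∪ avoidingSets) O := hO
  induction hO' with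
  | univ => exact ⟨∅, fun _ _ _ => trivial⟩
  | inter A B hA hB ihA ihB =>
    obtain ⟨E, hE⟩ := ihA hA hπ.1
    obtain ⟨F, hF⟩ := ihB hB hπ.2
    refine ⟨E ∪ F, fun f hf h => ⟨hE f hf fun x hx => h x ?_, hF f hf fun x hx => h x ?_⟩⟩
    · exact Finset.mem_union_left _ hx
    · exact Finset.mem_union_right _ hx
  | sUnion S hS ih =>
    obtain ⟨A, hA, hπA⟩ := hπ
    obtain ⟨E, hE⟩ := ih A hA (hS A hA) hπA
    exact ⟨E, fun f hf h => ⟨A, hA, hE f hf h⟩⟩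
  | basic A hA =>
    rcases hA with ((⟨x, y, rfl⟩ | ⟨I, J, p, q, h, rfl⟩) | ⟨L, U, hL, hU, rfl⟩) |
      ⟨q₁, q₂, K, -, -, rfl⟩
    · exact ⟨{x}, fun f _ h => (h x (by simp)).trans hπ⟩
    · refine ⟨{p}, fun f _ hf => ?_⟩
      have hfp : f p = π p := hf p (by simp)
      obtain ⟨a, b, ha, hb, hπa, hπb⟩ := hloc p
      rintro _ ⟨x, hx, rfl⟩
      rcases h with ⟨rfl, h⟩ | ⟨rfl, h⟩
      -- The point `a < p` of the fibre of `p` puts `π p` itself in `J`, so the value of `f` at `p`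
      -- alone controls `f` on `I`.
      · have h1 : π a ∈ J := hπ ⟨a, ha, rfl⟩
        have h2 : f x ≤ π a := by rw [hπa, ← hfp]; exact f.monotone (le_of_lt hx)
        rcases h with rfl | rfl
        · exact le_trans h2 h1
        · exact lt_of_le_of_lt h2 h1
      · have h1 : π b ∈ J := hπ ⟨b, hb, rfl⟩
        have h2 : π b ≤ f x := by rw [hπb, ← hfp]; exact f.monotone (le_of_lt hx)
        rcases h with rfl | rfl
        · exact le_trans h1 h2
        · exact lt_of_lt_of_le h1 h2
    · refine ⟨∅, fun f hf _ => ?_⟩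
      have h1 : infImage π ∈ L ∧ supImage π ∈ U := hπ
      change infImage f ∈ L ∧ supImage f ∈ U
      rwa [infImage_eq_bot hf, supImage_eq_top hf, ← infImage_eq_bot hub, ← supImage_eq_top hub]
    · refine ⟨∅, fun f _ _ => ?_⟩
      have h1 : range π ∩ ratPoints K = ∅ := hπ
      rw [hsurj.range_eq, univ_inter] at h1
      change range f ∩ ratPoints K = ∅
      rw [h1, inter_empty]

/-! ### Finite agreement and unbounded perturbations -/

lemma isOpen_pointwise_eval (x y : ℚ) : IsOpen[pointwiseTopology] {s : MQ | s x = y} := by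
  letI : TopologicalSpace ℚ := ⊥
  have : DiscreteTopology ℚ := ⟨rfl⟩
  have h : IsOpen ((fun f : ℚ → ℚ => f x) ⁻¹' {y}) :=
    IsOpen.preimage (continuous_apply x) (isOpen_discrete (α := ℚ) {y})
  exact ⟨_, h, rfl⟩

lemma isOpen_pointwise_agree (s : MQ) (F : Finset ℚ) :
    IsOpen[pointwiseTopology] {s' : MQ | ∀ x ∈ F, s' x = s x} := by
  let := pointwiseTopology
  have : {s' : MQ | ∀ x ∈ F, s' x = s x} = ⋂ x ∈ F, {s' : MQ | s' x = s x} := by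
    ext; simp
  rw [this]
  exact isOpen_biInter_finset fun x _ => isOpen_pointwise_eval x (s x)

lemma isOpen_pointwise_of_forall {O : Set MQ}
    (h : ∀ s ∈ O, ∃ F : Finset ℚ, ∀ s' : MQ, (∀ x ∈ F, s' x = s x) → s' ∈ O) :
    IsOpen[pointwiseTopology] O := by
  let := pointwiseTopology
  refine isOpen_iff_forall_mem_open.2 fun s hs => ?_
  obtain ⟨F, hF⟩ := h s hs
  exact ⟨_, hF, isOpen_pointwise_agree s F, fun x _ => rfl⟩

/-- Every increasing map agrees on a given finite set with one unbounded on both sides. -/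
lemma exists_unbounded_agree (s : MQ) (F : Finset ℚ) :
    ∃ s' : MQ, UnboundedBothSides s' ∧ ∀ x ∈ F, s' x = s x := by
  obtain ⟨b, hb⟩ := F.bddAbove
  obtain ⟨a, ha⟩ := F.bddBelow
  refine ⟨⟨fun x => s x + min (x - a) 0 + max (x - b) 0, fun x y h => ?_⟩, ⟨fun c => ?_, fun c => ?_⟩,
    fun x hx => ?_⟩
  · have := s.monotone h
    dsimp only
    gcongr
  · obtain ⟨t, h1, h2, h3⟩ : ∃ t, t ≤ a ∧ t ≤ b ∧ t ≤ a + c - s a :=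
      ⟨min (min a b) (a + c - s a), by simp, by simp, by simp⟩
    have h4 := s.monotone h1
    refine ⟨t, ?_⟩
    change s t + min (t - a) 0 + max (t - b) 0 ≤ c
    rw [max_eq_right (by linarith), min_eq_left (by linarith)]
    linarith
  · obtain ⟨t, h1, h2, h3⟩ : ∃ t, a ≤ t ∧ b ≤ t ∧ b + c - s b ≤ t :=
      ⟨max (max a b) (b + c - s b), by simp, by simp, by simp⟩
    have h4 := s.monotone h2
    refine ⟨t, ?_⟩
    change c ≤ s t + min (t - a) 0 + max (t - b) 0
    rw [min_eq_right (by linarith), max_eq_left (by linarith)]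
    linarith
  · have h1 := hb hx
    have h2 := ha hx
    change s x + min (x - a) 0 + max (x - b) 0 = s x
    rw [min_eq_right (by linarith), max_eq_right (by linarith)]
    simp

/-- Collapse `[a, b]` to `b` and fix everything else; `F` has no point in `[a, b)`. -/
lemma exists_unbounded_map_up {a b : ℚ} (hab : a < b) (F : Finset ℚ)
    (hF : ∀ d ∈ F, a ≤ d → b ≤ d) :
    ∃ k : MQ, UnboundedBothSides k ∧ (∀ d ∈ F, k d = d) ∧ k a = b := by
  refine ⟨⟨fun d => if d < a then d else max d b, fun x y h => ?_⟩, ⟨fun c => ?_, fun c => ?_⟩,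
    fun d hd => ?_, ?_⟩
  · dsimp only
    split_ifs <;> grind
  · refine ⟨min c (a - 1), ?_⟩
    change (if _ then _ else _) ≤ c
    grind
  · refine ⟨c, ?_⟩
    change c ≤ (if _ then _ else _)
    grind
  · have := hF d hd
    change (if _ then _ else _) = d
    grind
  · change (if _ then _ else _) = b
    grind

lemma exists_unbounded_map_down {a b : ℚ} (hab : b < a) (F : Finset ℚ)
    (hF : ∀ d ∈ F, d ≤ a → d ≤ b) :
    ∃ k : MQ, UnboundedBothSides k ∧ (∀ d ∈ F, k d = d) ∧ k a = b := by
  refine ⟨⟨fun d => if a < d then d else min d b, fun x y h => ?_⟩, ⟨fun c => ?_, fun c => ?_⟩,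
    fun d hd => ?_, ?_⟩
  · dsimp only
    split_ifs <;> grind
  · refine ⟨c, ?_⟩
    change (if _ then _ else _) ≤ c
    grind
  · refine ⟨max c (a + 1), ?_⟩
    change c ≤ (if _ then _ else _)
    grind
  · have := hF d hd
    change (if _ then _ else _) = d
    grind
  · change (if _ then _ else _) = b
    grind

/-! ### Attaining an omitted value -/

/-- If `s` omits the value `y`, then `s` factors as `f ∘ g` in such a way that `y` is attained by
`f ∘ k ∘ g` for some `k` arbitrarily close to the identity. -/
lemma exists_factorization_of_notMem_range (s : MQ) (y : ℚ) (hy : ∀ x, s x ≠ y) :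
    ∃ f g : MQ, f.comp g = s ∧ ∀ F : Finset ℚ, ∃ k : MQ,
      UnboundedBothSides k ∧ (∀ d ∈ F, k d = d) ∧ ∃ x, f (k (g x)) = y := by
  -- The graph of `s` with a copy of `ℚ` inserted over `y`, ordered lexicographically; it is
  -- isomorphic to `ℚ`. Then `f` is the first coordinate and `g` the graph embedding.
  let D : Type := {p : ℚ ×ₗ ℚ // (ofLex p).1 = s (ofLex p).2 ∨ (ofLex p).1 = y}
  let G : ℚ → D := fun x => ⟨toLex (s x, x), Or.inl rfl⟩
  let M : ℚ → D := fun r => ⟨toLex (y, r), Or.inr rfl⟩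
  have hcases : ∀ d : D, (∃ x, d = G x) ∨ ∃ r, d = M r := by
    rintro ⟨⟨v, x⟩, h | h⟩
    · exact Or.inl ⟨x, Subtype.ext (congrArg toLex (Prod.ext h rfl))⟩
    · exact Or.inr ⟨x, Subtype.ext (congrArg toLex (Prod.ext h rfl))⟩
  have hGG : ∀ {x x'}, G x < G x' ↔ x < x' := by
    intro x x'
    refine Prod.Lex.toLex_lt_toLex.trans ⟨?_, fun h => ?_⟩
    · rintro (h | h)
      · exact s.monotone.reflect_lt h
      · exact h.2
    · rcases (s.monotone h.le).lt_or_eq with h' | h'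
      · exact Or.inl h'
      · exact Or.inr ⟨h', h⟩
  have hMM : ∀ {r r'}, M r < M r' ↔ r < r' := by
    intro r r'
    refine Prod.Lex.toLex_lt_toLex.trans ⟨?_, fun h => Or.inr ⟨rfl, h⟩⟩
    rintro (h | h)
    · exact absurd h (lt_irrefl _)
    · exact h.2
  have hGM : ∀ {x r}, G x < M r ↔ s x < y := by
    intro x r
    refine Prod.Lex.toLex_lt_toLex.trans ⟨?_, fun h => Or.inl h⟩
    rintro (h | h)
    · exact h
    · exact absurd h.1 (hy x)
  have hMG : ∀ {x r}, M r < G x ↔ y < s x := by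
    intro x r
    refine Prod.Lex.toLex_lt_toLex.trans ⟨?_, fun h => Or.inl h⟩
    rintro (h | h)
    · exact h
    · exact absurd h.1.symm (hy x)
  have : Countable (ℚ ×ₗ ℚ) := inferInstanceAs (Countable (ℚ × ℚ))
  have : Countable D := inferInstanceAs (Countable (Subtype _))
  have : Nonempty D := ⟨G 0⟩
  have : NoMinOrder D := ⟨fun d => by
    rcases hcases d with ⟨x, rfl⟩ | ⟨x, rfl⟩
    · exact ⟨G (x - 1), hGG.2 (by simp)⟩
    · exact ⟨M (x - 1), hMM.2 (by simp)⟩⟩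
  have : NoMaxOrder D := ⟨fun d => by
    rcases hcases d with ⟨x, rfl⟩ | ⟨x, rfl⟩
    · exact ⟨G (x + 1), hGG.2 (by simp)⟩
    · exact ⟨M (x + 1), hMM.2 (by simp)⟩⟩
  have : DenselyOrdered D := ⟨fun d d' h => by
    rcases hcases d with ⟨x, rfl⟩ | ⟨x, rfl⟩ <;> rcases hcases d' with ⟨x', rfl⟩ | ⟨x', rfl⟩
    · obtain ⟨z, hz, hz'⟩ := exists_between (hGG.1 h)
      exact ⟨G z, hGG.2 hz, hGG.2 hz'⟩
    · exact ⟨M (x' - 1), hGM.2 (hGM.1 h), hMM.2 (by simp)⟩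
    · exact ⟨M (x + 1), hMM.2 (by simp), hMG.2 (hMG.1 h)⟩
    · obtain ⟨z, hz, hz'⟩ := exists_between (hMM.1 h)
      exact ⟨M z, hMM.2 hz, hMM.2 hz'⟩⟩
  obtain ⟨e⟩ := Order.iso_of_countable_dense ℚ D
  have hGmono : StrictMono G := fun _ _ h => hGG.2 h
  refine ⟨⟨fun p => (ofLex (e p).1).1, fun a b h => Prod.Lex.monotone_fst _ _ (e.monotone h)⟩,
    ⟨fun x => e.symm (G x), fun a b h => e.symm.monotone (hGmono.monotone h)⟩, ?_, fun F => ?_⟩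
  · ext x
    change (ofLex (e (e.symm (G x))).1).1 = s x
    rw [e.apply_symm_apply]
    rfl
  -- It is enough to move a graph point onto a point over `y` without crossing `F`.
  suffices h : ∃ x r, (G x < M r ∧ ∀ d ∈ F, G x ≤ e d → M r ≤ e d) ∨
      (M r < G x ∧ ∀ d ∈ F, e d ≤ G x → e d ≤ M r) by
    obtain ⟨x, r, ⟨h1, h2⟩ | ⟨h1, h2⟩⟩ := h
    · obtain ⟨k, hk, hkF, hkx⟩ := exists_unbounded_map_up (e.symm.strictMono h1) F
        fun d hd h => by
          rw [e.symm_apply_le] at h ⊢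
          exact h2 d hd h
      refine ⟨k, hk, hkF, x, ?_⟩
      change (ofLex (e (k (e.symm (G x)))).1).1 = y
      rw [hkx, e.apply_symm_apply]
      rfl
    · obtain ⟨k, hk, hkF, hkx⟩ := exists_unbounded_map_down (e.symm.strictMono h1) F
        fun d hd h => by
          rw [e.le_symm_apply] at h ⊢
          exact h2 d hd h
      refine ⟨k, hk, hkF, x, ?_⟩
      change (ofLex (e (k (e.symm (G x)))).1).1 = y
      rw [hkx, e.apply_symm_apply]
      rfl
  let snd : ℚ → ℚ := fun d => (ofLex (e d).1).2
  have hsndG : ∀ {d x}, e d = G x → snd d = x := fun {d x} h => by simp only [snd, h]; rfl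
  have hsndM : ∀ {d r}, e d = M r → snd d = r := fun {d x} h => by simp only [snd, h]; rfl
  obtain ⟨lo, hlo⟩ := (F.image snd).bddBelow
  obtain ⟨hi, hhi⟩ := (F.image snd).bddAbove
  replace hlo : ∀ d ∈ F, lo ≤ snd d := fun d hd => hlo (by simpa using ⟨d, hd, rfl⟩)
  replace hhi : ∀ d ∈ F, snd d ≤ hi := fun d hd => hhi (by simpa using ⟨d, hd, rfl⟩)
  by_cases hL : ∃ x, s x < y ∧ ∀ d ∈ F, s (snd d) < y → snd d < x
  · obtain ⟨x, hx, hxF⟩ := hL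
    refine ⟨x, lo, Or.inl ⟨hGM.2 hx, fun d hd h => ?_⟩⟩
    rcases hcases (e d) with ⟨z, hz⟩ | ⟨z, hz⟩
    · rw [hz] at h ⊢
      refine (hMG.2 (lt_of_le_of_ne (le_of_not_gt fun h' => ?_) (hy z).symm)).le
      have := hxF d hd (by rwa [hsndG hz])
      rw [hsndG hz] at this
      exact absurd (hGG.2 this) h.not_gt
    · rw [hz]
      refine le_of_not_gt fun h' => ?_
      have := hlo d hd
      rw [hsndM hz] at this
      exact absurd (hMM.1 h') this.not_gt
  · by_cases hR : ∃ x, y < s x ∧ ∀ d ∈ F, y < s (snd d) → x < snd d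
    · obtain ⟨x, hx, hxF⟩ := hR
      refine ⟨x, hi, Or.inr ⟨hMG.2 hx, fun d hd h => ?_⟩⟩
      rcases hcases (e d) with ⟨z, hz⟩ | ⟨z, hz⟩
      · rw [hz] at h ⊢
        refine (hGM.2 (lt_of_le_of_ne (le_of_not_gt fun h' => ?_) (hy z))).le
        have := hxF d hd (by rwa [hsndG hz])
        rw [hsndG hz] at this
        exact absurd (hGG.2 this) h.not_gt
      · rw [hz]
        refine le_of_not_gt fun h' => ?_
        have := hhi d hd
        rw [hsndM hz] at this
        exact absurd (hMM.1 h') this.not_gt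
    -- Otherwise finiteness of `F` makes `{s < y}`, if nonempty, have a maximum and `{s > y}` a
    -- minimum. These sets cover `ℚ`, which is impossible.
    · exfalso
      push Not at hL hR
      have hmax : (∃ x, s x < y) → ∃ a, s a < y ∧ ∀ x, s x < y → x ≤ a := by
        rintro ⟨x, hx⟩
        obtain ⟨d, hd, hdy, -⟩ := hL x hx
        obtain ⟨m, hm, hmax⟩ := Finset.exists_max_image (F.filter fun d => s (snd d) < y) snd
          ⟨d, Finset.mem_filter.2 ⟨hd, hdy⟩⟩
        refine ⟨snd m, (Finset.mem_filter.1 hm).2, fun z hz => ?_⟩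
        obtain ⟨d', hd', hdy', hzd⟩ := hL z hz
        exact hzd.trans (hmax d' (Finset.mem_filter.2 ⟨hd', hdy'⟩))
      have hmin : (∃ x, y < s x) → ∃ a, y < s a ∧ ∀ x, y < s x → a ≤ x := by
        rintro ⟨x, hx⟩
        obtain ⟨d, hd, hdy, -⟩ := hR x hx
        obtain ⟨m, hm, hmin⟩ := Finset.exists_min_image (F.filter fun d => y < s (snd d)) snd
          ⟨d, Finset.mem_filter.2 ⟨hd, hdy⟩⟩
        refine ⟨snd m, (Finset.mem_filter.1 hm).2, fun z hz => ?_⟩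
        obtain ⟨d', hd', hdy', hzd⟩ := hR z hz
        exact (hmin d' (Finset.mem_filter.2 ⟨hd', hdy'⟩)).trans hzd
      have hlow : ∃ x, s x < y := by
        by_contra! h
        have h' : ∀ x, y < s x := fun x => lt_of_le_of_ne (h x) (hy x).symm
        obtain ⟨a, -, ha⟩ := hmin ⟨0, h' 0⟩
        linarith [ha (a - 1) (h' _)]
      obtain ⟨a, hay, ha⟩ := hmax hlow
      have hup : y < s (a + 1) := by
        refine lt_of_le_of_ne (le_of_not_gt fun h => ?_) (hy _).symm
        linarith [ha _ h]
      obtain ⟨b, hby, hb⟩ := hmin ⟨_, hup⟩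
      obtain ⟨m, ham, hmb⟩ := exists_between (s.monotone.reflect_lt (hay.trans hby))
      rcases lt_or_gt_of_ne (hy m) with h | h
      · exact absurd (ha m h) ham.not_ge
      · exact absurd (hb m h) hmb.not_ge

/-! ### Transfer to the semigroup topology -/

section PolishSemigroup

variable [TopologicalSpace MQ]

lemma continuous_comp_comp (hcomp : Continuous fun p : MQ × MQ => p.1.comp p.2) (f : MQ) :
    Continuous fun p : MQ × MQ => f.comp (p.1.comp p.2) := by
  have h : Continuous fun q : MQ => f.comp q :=
    hcomp.comp (continuous_const.prodMk continuous_id)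
  exact h.comp hcomp

/-- In a semigroup topology coarser than the rich one, neighbourhoods of the identity contain all
unbounded maps which agree with the identity on some finite set. -/
lemma exists_finset_of_isOpen_of_id_mem (hcomp : Continuous fun p : MQ × MQ => p.1.comp p.2)
    (hrich : ∀ O : Set MQ, IsOpen O → IsOpen[richTopology] O) {W : Set MQ} (hW : IsOpen W)
    (hid : OrderHom.id ∈ W) :
    ∃ F : Finset ℚ, ∀ k : MQ, UnboundedBothSides k → (∀ x ∈ F, k x = x) → k ∈ W := by
  obtain ⟨π, j, hπ, hj', -, hloc⟩ := exists_locallyConstant_surjection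
  let ι : MQ := ⟨fun y => j y 0, fun a b h => by
    rcases h.lt_or_eq with h | rfl
    · exact (hj' _ _ _ _ h).le
    · exact le_rfl⟩
  have hι : ∀ k : MQ, (k.comp π).comp ι = k := fun k => by
    ext y
    exact congrArg k (hπ y 0)
  have hcont : Continuous fun f : MQ => f.comp ι :=
    hcomp.comp (continuous_id.prodMk continuous_const)
  have hmem : π ∈ (fun f : MQ => f.comp ι) ⁻¹' W := by
    have h := hι OrderHom.id
    change π.comp ι ∈ W
    rw [show π.comp ι = OrderHom.id from h]
    exact hid
  obtain ⟨E, hE⟩ := exists_finset_of_isOpen_rich (fun y => ⟨j y 0, hπ y 0⟩) hloc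
    (hrich _ (hW.preimage hcont)) hmem
  refine ⟨E.image π, fun k hk hkE => ?_⟩
  rw [← hι k]
  refine hE (k.comp π) ⟨fun c => ?_, fun c => ?_⟩ fun x hx => hkE _ (Finset.mem_image_of_mem _ hx)
  · obtain ⟨x, hx⟩ := hk.1 c
    refine ⟨j x 0, ?_⟩
    change k (π _) ≤ c
    rwa [hπ]
  · obtain ⟨x, hx⟩ := hk.2 c
    refine ⟨j x 0, ?_⟩
    change c ≤ k (π _)
    rwa [hπ]

/-- The surjective maps are dense in every Polish semigroup topology between the pointwise and the
rich one. -/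
lemma dense_surjective [BaireSpace MQ] (hcomp : Continuous fun p : MQ × MQ => p.1.comp p.2)
    (hpw : ∀ O : Set MQ, IsOpen[pointwiseTopology] O → IsOpen O)
    (hrich : ∀ O : Set MQ, IsOpen O → IsOpen[richTopology] O) :
    Dense {s : MQ | Function.Surjective s} := by
  have heq : {s : MQ | Function.Surjective s} = ⋂ y : ℚ, {s : MQ | ∃ x, s x = y} := by
    ext s
    simp [Function.Surjective]
  rw [heq]
  refine dense_iInter_of_isOpen (fun y => ?_) fun y => ?_
  · have : {s : MQ | ∃ x, s x = y} = ⋃ x, {s : MQ | s x = y} := by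
      ext s
      simp
    rw [this]
    exact isOpen_iUnion fun x => hpw _ (isOpen_pointwise_eval x y)
  · refine dense_iff_inter_open.2 fun O hO ⟨s, hs⟩ => ?_
    by_cases hy : ∃ x, s x = y
    · exact ⟨s, hs, hy⟩
    push Not at hy
    obtain ⟨f, g, hfg, H⟩ := exists_factorization_of_notMem_range s y hy
    have hcont : Continuous fun k : MQ => f.comp (k.comp g) :=
      (continuous_comp_comp hcomp f).comp (continuous_id.prodMk continuous_const)
    have hmem : f.comp (OrderHom.id.comp g) ∈ O := by
      rw [OrderHom.id_comp, hfg]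
      exact hs
    obtain ⟨F, hF⟩ := exists_finset_of_isOpen_of_id_mem hcomp hrich (hO.preimage hcont) hmem
    obtain ⟨k, hk, hkF, x, hx⟩ := H F
    exact ⟨f.comp (k.comp g), hF k hk hkF, x, hx⟩

/-- Every neighbourhood of `s` contains all unbounded maps which agree with `s` on some finite
set. -/
lemma exists_finset_of_isOpen [BaireSpace MQ]
    (hcomp : Continuous fun p : MQ × MQ => p.1.comp p.2)
    (hpw : ∀ O : Set MQ, IsOpen[pointwiseTopology] O → IsOpen O)
    (hrich : ∀ O : Set MQ, IsOpen O → IsOpen[richTopology] O) {O : Set MQ} (hO : IsOpen O)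
    {s : MQ} (hs : s ∈ O) :
    ∃ F : Finset ℚ, ∀ s' : MQ, UnboundedBothSides s' → (∀ x ∈ F, s' x = s x) → s' ∈ O := by
  obtain ⟨π, j, hπ, hj', hj, -⟩ := exists_locallyConstant_surjection
  have hlift : ∀ r : MQ, StrictMono fun x => j (r x) x := fun r a b h => by
    rcases (r.monotone h.le).lt_or_eq with h' | h'
    · exact hj' _ _ _ _ h'
    · change j (r a) a < j (r b) b
      rw [h']
      exact hj _ _ _ h
  let g : MQ := ⟨fun x => j (s x) x, (hlift s).monotone⟩
  have hg : π.comp (g.comp OrderHom.id) = s := by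
    ext x
    exact hπ _ _
  have hopen := hO.preimage (continuous_comp_comp hcomp π)
  obtain ⟨V, W, hV, hW, hgV, hidW, hVW⟩ := isOpen_prod_iff.1 hopen g OrderHom.id
    (by change π.comp (g.comp OrderHom.id) ∈ O; rwa [hg])
  obtain ⟨F, hF⟩ := exists_finset_of_isOpen_of_id_mem hcomp hrich hW hidW
  obtain ⟨g', ⟨hg'V, hg'F⟩, hg'⟩ := (dense_surjective hcomp hpw hrich).inter_open_nonempty _
    (hV.inter (hpw _ (isOpen_pointwise_agree g F))) ⟨g, hgV, fun _ _ => rfl⟩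
  refine ⟨F, fun s' hs' hs'F => ?_⟩
  -- Solve `g' ∘ K = (x ↦ j (s' x) x)` pointwise. On `F` the choice `z = x` works since `g'` agrees
  -- there with `g`, and `s'` with `s`. Strictness of the right side forces `K` to be monotone.
  have hsec : ∀ x, ∃ z, g' z = j (s' x) x ∧ (x ∈ F → z = x) := fun x => by
    by_cases hx : x ∈ F
    · refine ⟨x, ?_, fun _ => rfl⟩
      rw [hg'F x hx, hs'F x hx]
      rfl
    · obtain ⟨z, hz⟩ := hg' (j (s' x) x)
      exact ⟨z, hz, fun h => absurd h hx⟩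
  choose k hk hkF using hsec
  have hkmono : Monotone k := fun a b h => by
    rcases h.lt_or_eq with h | rfl
    · refine (g'.monotone.reflect_lt ?_).le
      rw [hk, hk]
      exact hlift s' h
    · exact le_rfl
  let K : MQ := ⟨k, hkmono⟩
  have hs'eq : π.comp (g'.comp K) = s' := by
    ext x
    change π (g' (k x)) = s' x
    rw [hk, hπ]
  have hK : UnboundedBothSides K := by
    constructor <;> intro c <;> by_contra! h
    · obtain ⟨x, hx⟩ := hs'.1 (π (g' c) - 1)
      have h1 : π (g' c) ≤ π (g' (k x)) := π.monotone (g'.monotone (h x).le)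
      rw [hk, hπ] at h1
      linarith
    · obtain ⟨x, hx⟩ := hs'.2 (π (g' c) + 1)
      have h1 : π (g' (k x)) ≤ π (g' c) := π.monotone (g'.monotone (h x).le)
      rw [hk, hπ] at h1
      linarith
  have hmem : (g', K) ∈ V ×ˢ W := ⟨hg'V, hF K hK fun x hx => hkF x hx⟩
  rw [← hs'eq]
  exact hVW hmem

lemma isOpen_pointwise_of_isOpen [BaireSpace MQ] [RegularSpace MQ]
    (hcomp : Continuous fun p : MQ × MQ => p.1.comp p.2)
    (hpw : ∀ O : Set MQ, IsOpen[pointwiseTopology] O → IsOpen O)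
    (hrich : ∀ O : Set MQ, IsOpen O → IsOpen[richTopology] O) {O : Set MQ} (hO : IsOpen O) :
    IsOpen[pointwiseTopology] O := by
  refine isOpen_pointwise_of_forall fun s hs => ?_
  obtain ⟨C, hC, hCclosed, hCO⟩ := exists_mem_nhds_isClosed_subset (hO.mem_nhds hs)
  obtain ⟨F, hF⟩ := exists_finset_of_isOpen hcomp hpw hrich isOpen_interior
    (mem_interior_iff_mem_nhds.2 hC)
  refine ⟨F, fun s' hs' => hCO (hCclosed.closure_subset (mem_closure_iff.2 fun N hN hs'N => ?_))⟩
  obtain ⟨E, hE⟩ := exists_finset_of_isOpen hcomp hpw hrich hN hs'N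
  -- An unbounded `r` agreeing with `s'` on both finite sets lies in `N` and in `C`, so `s'` is in
  -- the closure of `C`.
  obtain ⟨r, hr, hrEF⟩ := exists_unbounded_agree s' (E ∪ F)
  refine ⟨r, hE r hr fun x hx => hrEF x (Finset.mem_union_left _ hx),
    interior_subset (hF r hr fun x hx => ?_)⟩
  rw [hrEF x (Finset.mem_union_right _ hx), hs' x hx]

end PolishSemigroup

theorem mainTheorem3 (T : TopologicalSpace MQ) (hT : IsPolishSemigroupTopology T)
    (hpw : ∀ O : Set MQ, IsOpen[pointwiseTopology] O → IsOpen[T] O)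
    (hrich : ∀ O : Set MQ, IsOpen[T] O → IsOpen[richTopology] O) :
    T = pointwiseTopology := by
  obtain ⟨hPolish, hcomp⟩ := hT
  have hreg : RegularSpace MQ := by
    let := TopologicalSpace.upgradeIsCompletelyMetrizable MQ
    infer_instance
  exact TopologicalSpace.ext_iff.2 fun O =>
    ⟨fun hO => isOpen_pointwise_of_isOpen hcomp hpw hrich hO, hpw O⟩
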